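/- **Setting.** Let $\mathbb K$ be $\mathbb R$ or $\mathbb C$, $p\in[1,\infty]$, and let $V$ be a finite-dimensional normed space over $\mathbb K$. A countable group $\Gamma$ is amenable if it has a Følner sequence, i.e. a sequence $(\Omega_i)$ of non-empty finite subsets such that, for every finite $F\subset\Gamma$, $|\partial_F\Omega_i|/|\Omega_i|\to0$, where $\partial_F\Omega=\{\gamma\in\Gamma:\gamma F\cap\Omega\ne\emptyset\text{ and }\gamma F\cap(\Gamma\setminus\Omega)\neq\emptyset\}$. The group acts on $\ell^p(\Gamma;V)$ by $(\gamma\cdot y)(\eta)=y(\gamma^{-1}\eta)$. For a subset $X$ of a vector space $E$ with a pseudo-norm $q$, let $\mathrm{ldim}_\varepsilon(X,q)$ be the smallest dimension of a vector space $E'$ for which there is a linear map $f:E\to E'$ such that $q(x-x')\le\varepsilon$ for all $x,x'\in X\cap\ker f$. For a $\Gamma$-invariant linear subspace $Y\subset\ell^p(\Gamma;V)$ and a Følner sequence $(\Omega_i)$ put $$\dim_{\ell^p}(Y,\Gamma,(\Omega_i))=\lim_{\varepsilon\to0}\limsup_{i\to\infty}\frac{\mathrm{ldim}_\varepsilon\big(\{y\in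 Y:\|y\|_{\ell^p(\Gamma;V)}\le1\},\ \|\cdot\|_{\ell^p(\Omega_i;V)}\big)}{|\Omega_i|},$$ and let $\dim_{\ell^p}(Y,\Gamma)$ be the largest value (supremum) of this number over all Følner sequences of $\Gamma$ (so it is the common value whenever the number does not depend on the Følner sequence). **Proposition 7.5.** Let $\Gamma_2$ be a countable amenable group and $\Gamma_1\subset\Gamma_2$ a subgroup of finite index. Let $T\subset\Gamma_2$ be a set of representatives of the cosets $\Gamma_1t$, so that $|T|=[\Gamma_2:\Gamma_1]$, and give $V^{T}\cong V^{[\Gamma_2:\Gamma_1]}$ any norm. Let $Y\subset\ell^p(\Gamma_2;V)$ be a $\Gamma_2$-invariant linear subspace, and let $Y_1\subset\ell^p(\Gamma_1;V^{T})$ be $Y$ seen by restriction, i.e. the set of all functions $\gamma_1\mapsto(y(\gamma_1t))_{t\in T}$ with $y\in Y$. Then $$[\Gamma_2:\Gamma_1]\cdot\dim_{\ell^p}(Y,\Gamma_2)=\dim_{\ell^p}(Y_1,\Gamma_1).$$ Moreover: 1. for every Følner sequence $(\Omega_i)$ of $\Gamma_1$, $(\Omega_iT)$ is a Følner sequence of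 $\Gamma_2$ and $[\Gamma_2:\Gamma_1]\cdot\dim_{\ell^p}(Y,\Gamma_2,(\Omega_iT))=\dim_{\ell^p}(Y_1,\Gamma_1,(\Omega_i))$; 2. for every Følner sequence $(\Omega_i)$ of $\Gamma_2$ there is a Følner sequence $(\Omega_i')$ of $\Gamma_1$ with $[\Gamma_2:\Gamma_1]\cdot\dim_{\ell^p}(Y,\Gamma_2,(\Omega_i))=\dim_{\ell^p}(Y_1,\Gamma_1,(\Omega_i'))$. -/

import Mathlib

open Filter Topology
open scoped ENNReal

noncomputable section

namespace LpDim

/-! ### Følner sequences -/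

/-- The `F`-boundary of `Ω`: all `γ` such that `γF` meets both `Ω` and its complement. -/
def boundary {Γ : Type*} [Group Γ] (F Ω : Finset Γ) : Set Γ :=
  {γ | (∃ f ∈ F, γ * f ∈ Ω) ∧ ∃ f ∈ F, γ * f ∉ Ω}

/-- The relative amenability function `α(Ω; F) = |∂_F Ω| / |Ω|`
(used for non-empty `Ω` only; the boundary of a finite set is finite). -/
def relAmen {Γ : Type*} [Group Γ] (Ω F : Finset Γ) : ℝ :=
  ((boundary F Ω).ncard : ℝ) / (Ω.card : ℝ)

/-- Følner sequences: non-empty finite sets with `α(Ω i; F) → 0` for every finite `F`. -/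
def IsFolnerSeq {Γ : Type*} [Group Γ] (Ω : ℕ → Finset Γ) : Prop :=
  (∀ i, (Ω i).Nonempty) ∧
    ∀ F : Finset Γ, Tendsto (fun i => relAmen (Ω i) F) atTop (𝓝 0)

/-- A (countable) group is amenable if it has a Følner sequence. -/
def IsAmenable (Γ : Type*) [Group Γ] : Prop :=
  ∃ Ω : ℕ → Finset Γ, IsFolnerSeq Ω

/-! ### The linear width -/

/-- `ldim_ε(X, q)`: the smallest dimension `n` of a target of a linear map `f` on `E` such that
`ker f ∩ X` has diameter at most `ε` for the pseudo-norm `q` (and `⊤` if there is no such map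
with a finite-dimensional target). -/
def ldim {𝕜 E : Type*} [RCLike 𝕜] [AddCommGroup E] [Module 𝕜 E]
    (ε : ℝ) (X : Set E) (q : Seminorm 𝕜 E) : ℕ∞ :=
  ⨅ (n : ℕ) (_ : ∃ f : E →ₗ[𝕜] (Fin n → 𝕜),
      ∀ x ∈ X, ∀ x' ∈ X, f x = 0 → f x' = 0 → q (x - x') ≤ ε), (n : ℕ∞)

section

variable (𝕜 : Type*) {Γ V : Type*} [RCLike 𝕜] [Group Γ] [NormedAddCommGroup V] [NormedSpace 𝕜 V]
  {p : ℝ≥0∞} [Fact (1 ≤ p)]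

/-- Restriction of a function in `ℓ^p(Γ; V)` to a finite set `Ω`. -/
def restrict (Ω : Finset Γ) : lp (fun _ : Γ => V) p →ₗ[𝕜] PiLp p (fun _ : Ω => V) where
  toFun y := WithLp.toLp p (fun γ : Ω => y (γ : Γ))
  map_add' _ _ := rfl
  map_smul' _ _ := rfl

/-- The pseudo-norm `y ↦ ‖y‖_{ℓ^p(Ω)}` on `ℓ^p(Γ; V)`, for a finite set `Ω`: the `p`-th root of
`∑ γ ∈ Ω, ‖y γ‖ ^ p` if `p < ∞`, and the maximum of `‖y γ‖` over `γ ∈ Ω` if `p = ∞`. -/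
def evSeminorm (Ω : Finset Γ) : Seminorm 𝕜 (lp (fun _ : Γ => V) p) :=
  (normSeminorm 𝕜 (PiLp p (fun _ : Ω => V))).comp (restrict 𝕜 Ω)

variable {𝕜}

/-- `Y` is invariant under the translations `(γ · y)(η) = y(γ⁻¹ η)`. -/
def IsInvariant (Y : Submodule 𝕜 (lp (fun _ : Γ => V) p)) : Prop :=
  ∀ γ : Γ, ∀ y ∈ Y, ∃ z ∈ Y, ∀ η : Γ, z η = y (γ⁻¹ * η)

/-- The unit ball of `Y ⊆ ℓ^p(Γ; V)`. -/
def unitBall (Y : Submodule 𝕜 (lp (fun _ : Γ => V) p)) : Set (lp (fun _ : Γ => V) p) :=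
  {y | y ∈ Y ∧ ‖y‖ ≤ 1}

/-- `limsup_i ldim_ε(B_1^Y, ‖·‖_{ℓ^p(Ω i)}) / |Ω i|`. -/
def meanLdim (Ω : ℕ → Finset Γ) (Y : Submodule 𝕜 (lp (fun _ : Γ => V) p)) (ε : ℝ) : ℝ≥0∞ :=
  limsup (fun i =>
    ((ldim ε (unitBall Y) (evSeminorm 𝕜 (Ω i)) : ℕ∞) : ℝ≥0∞) / ((Ω i).card : ℝ≥0∞)) atTop

/-- The `ℓ^p` dimension of `Y` along the sequence `Ω`: the limit of `meanLdim Ω Y ε` as `ε → 0`.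
It is written as a supremum over `ε > 0` because `meanLdim Ω Y ε` increases as `ε` decreases;
`tendsto_meanLdim` below shows that it is the limit. -/
def lpDimAlong (Ω : ℕ → Finset Γ) (Y : Submodule 𝕜 (lp (fun _ : Γ => V) p)) : ℝ≥0∞ :=
  ⨆ (ε : ℝ) (_ : 0 < ε), meanLdim Ω Y ε

/-- The `ℓ^p` dimension of `Y`, with no Følner sequence singled out: the largest value of
`lpDimAlong Ω Y` over the Følner sequences `Ω` of the group. It is the common value of the
`lpDimAlong Ω Y` whenever these agree. -/
def lpDim (Y : Submodule 𝕜 (lp (fun _ : Γ => V) p)) : ℝ≥0∞ :=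
  ⨆ (Ω : ℕ → Finset Γ) (_ : IsFolnerSeq Ω), lpDimAlong Ω Y

lemma meanLdim_anti (Ω : ℕ → Finset Γ) (Y : Submodule 𝕜 (lp (fun _ : Γ => V) p)) :
    Antitone (meanLdim Ω Y) := by
  intro ε ε' h
  refine limsup_le_limsup (Eventually.of_forall fun i => ?_)
  refine ENNReal.div_le_div_right (ENat.toENNReal_le.2 ?_) _
  refine le_iInf₂ fun n hn => ?_
  obtain ⟨f, hf⟩ := hn
  exact iInf₂_le n ⟨f, fun x hx x' hx' h1 h2 => (hf x hx x' hx' h1 h2).trans h⟩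

lemma tendsto_meanLdim (Ω : ℕ → Finset Γ) (Y : Submodule 𝕜 (lp (fun _ : Γ => V) p)) :
    Tendsto (meanLdim Ω Y) (𝓝[>] 0) (𝓝 (lpDimAlong Ω Y)) := by
  have h := (((meanLdim_anti Ω Y).antitoneOn (Set.Ioi 0))).tendsto_nhdsGT
    (OrderTop.bddAbove _)
  rwa [sSup_image] at h

/-- The dimension is a finite number. -/
lemma lpDimAlong_le [FiniteDimensional 𝕜 V] (Ω : ℕ → Finset Γ)
    (Y : Submodule 𝕜 (lp (fun _ : Γ => V) p)) :
    lpDimAlong Ω Y ≤ (Module.finrank 𝕜 V : ℝ≥0∞) := by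
  refine iSup₂_le fun ε hε => ?_
  refine (limsup_le_limsup (v := fun _ => (Module.finrank 𝕜 V : ℝ≥0∞))
    (Eventually.of_forall fun i => ?_)).trans (limsup_const _).le
  refine ENNReal.div_le_of_le_mul ?_
  have hle : ldim ε (unitBall Y) (evSeminorm 𝕜 (Ω i)) ≤
      ((Module.finrank 𝕜 (PiLp p (fun _ : Ω i => V)) : ℕ) : ℕ∞) := by
    refine iInf₂_le _ ⟨(Module.finBasis 𝕜 (PiLp p (fun _ : Ω i => V))).equivFun.toLinearMap ∘ₗ
      restrict 𝕜 (Ω i), fun x _ x' _ h h' => ?_⟩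
    have h1 : restrict 𝕜 (Ω i) x = 0 := by simpa using h
    have h2 : restrict 𝕜 (Ω i) x' = 0 := by simpa using h'
    simp [evSeminorm, h1, h2, hε.le]
  have hfr : Module.finrank 𝕜 (PiLp p (fun _ : Ω i => V)) =
      (Ω i).card * Module.finrank 𝕜 V := by
    rw [(WithLp.linearEquiv p 𝕜 (Ω i → V)).finrank_eq, Module.finrank_pi_fintype]
    simp
  rw [hfr] at hle
  refine (ENat.toENNReal_le.2 hle).trans ?_
  simp [mul_comm]

end

/-! ### Restriction to a subgroup of finite index -/

open Classical in
/-- The product set `ΩT ⊆ Γ₂` for finite sets `Ω ⊆ Γ₁` and `T ⊆ Γ₂`. -/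
def mulTransversal {Γ₂ : Type*} [Group Γ₂] {Γ₁ : Subgroup Γ₂} (Ω : Finset Γ₁) (T : Finset Γ₂) :
    Finset Γ₂ :=
  (Ω ×ˢ T).image fun x => (x.1 : Γ₂) * x.2

/-- The subspace `Y ⊆ ℓ^p(Γ₂; V)` seen by restriction as a subspace of `ℓ^p(Γ₁; V^T)`, where `T`
is a set of representatives of the cosets `Γ₁ t`. Here `W` is the vector space `V^T` (through `e`)
with some norm. An element `y` of `Y` is seen as the function sending `γ₁` to the family
`(y (γ₁ t))_{t ∈ T}`. -/
def reduced {𝕜 Γ₂ V W : Type*} [RCLike 𝕜] [Group Γ₂]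
    [NormedAddCommGroup V] [NormedSpace 𝕜 V] [NormedAddCommGroup W] [NormedSpace 𝕜 W]
    {p : ℝ≥0∞} [Fact (1 ≤ p)]
    (Γ₁ : Subgroup Γ₂) (T : Finset Γ₂) (e : W ≃ₗ[𝕜] (T → V))
    (Y : Submodule 𝕜 (lp (fun _ : Γ₂ => V) p)) : Submodule 𝕜 (lp (fun _ : Γ₁ => W) p) where
  carrier := {y₁ | ∃ y ∈ Y, ∀ (γ₁ : Γ₁) (t : T), e (y₁ γ₁) t = y ((γ₁ : Γ₂) * (t : Γ₂))}
  add_mem' := by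
    rintro a b ⟨y, hy, hya⟩ ⟨z, hz, hzb⟩
    exact ⟨y + z, Y.add_mem hy hz, fun γ₁ t => by simp [hya, hzb]⟩
  zero_mem' := ⟨0, Y.zero_mem, fun γ₁ t => by simp⟩
  smul_mem' := by
    rintro c a ⟨y, hy, hya⟩
    exact ⟨c • y, Y.smul_mem c hy, fun γ₁ t => by simp [hya]⟩

end LpDim

end

/-! Folding `y` into `γ ↦ (y (γ t))_t` is a linear isomorphism `Φ` from `ℓ^p(Γ₂; V)` onto `ℓ^p(Γ₁;
W)` that carries `Y` onto `reduced Γ₁ T e Y`. It is bounded both ways by one constant `C`, globally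
and also between the local norms on `ΩT` and on `Ω` (`exists_fold`). Passing through `Φ` therefore
only replaces `ε` by a fixed multiple, which the supremum over `ε > 0` absorbs, and `|ΩT| = |Ω| |T|`
produces the index.

A Følner sequence of `Γ₂` need not consist of sets `ΩT`, so `Ω` is enlarged to `(hull Ω)T`. The
added points number at most `|T| |∂_T Ω|`, and each costs at most `dim V` in `ldim`; the dimension
is thus unchanged (`lpDimAlong_eq_of_subset`). Both passages preserve the Følner property, so the
two suprema defining `lpDim` correspond. -/

noncomputable section

namespace LpDim

/-! ### Local `ℓ^p` norms on finite sets, for all `p ∈ [1, ∞]` -/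

section Norms

variable {ι κ V W : Type*} [NormedAddCommGroup V] [NormedAddCommGroup W]
  {p : ℝ≥0∞} [Fact (1 ≤ p)]

/-- Comparison of `ℓ^p` norms along a map with fibres of bounded size. -/
lemma norm_toLp_le_of_fiber_card_le [Fintype ι] [Fintype κ] {f : ι → W} {g : κ → V}
    (s : ι → κ) {m : ℕ} (hm : 1 ≤ m) (hs : ∀ k, {i | s i = k}.ncard ≤ m) {C : ℝ} (hC : 0 ≤ C)
    (h : ∀ i, ‖f i‖ ≤ C * ‖g (s i)‖) :
    ‖(WithLp.toLp p f : PiLp p fun _ : ι => W)‖ ≤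
      m * C * ‖(WithLp.toLp p g : PiLp p fun _ : κ => V)‖ := by
  classical
  have hm' : (1 : ℝ) ≤ m := by exact_mod_cast hm
  have hp1 : 1 ≤ p := Fact.out
  rcases eq_or_ne p ∞ with rfl | hp
  · rw [PiLp.norm_eq_ciSup (WithLp.toLp ∞ f : PiLp ∞ fun _ : ι => W)]
    refine Real.iSup_le (fun i => ?_) (by positivity)
    calc ‖f i‖ ≤ C * ‖g (s i)‖ := h i
      _ ≤ C * ‖(WithLp.toLp ∞ g : PiLp ∞ fun _ : κ => V)‖ := by
          gcongr
          exact PiLp.norm_apply_le (WithLp.toLp ∞ g : PiLp ∞ fun _ : κ => V) (s i)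
      _ ≤ m * C * ‖(WithLp.toLp ∞ g : PiLp ∞ fun _ : κ => V)‖ := by
          rw [mul_assoc]
          exact le_mul_of_one_le_left (by positivity) hm'
  · have hp0 : 0 < p.toReal := ENNReal.toReal_pos (zero_lt_one.trans_le hp1).ne' hp
    have hpr : 1 ≤ p.toReal := by
      rw [← ENNReal.toReal_one]; exact ENNReal.toReal_mono hp hp1
    rw [PiLp.norm_eq_sum hp0, PiLp.norm_eq_sum hp0]
    have key : ∑ i, ‖f i‖ ^ p.toReal ≤ (m * C) ^ p.toReal * ∑ k, ‖g k‖ ^ p.toReal := by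
      calc ∑ i, ‖f i‖ ^ p.toReal ≤ ∑ i, C ^ p.toReal * ‖g (s i)‖ ^ p.toReal := by
            refine Finset.sum_le_sum fun i _ => ?_
            rw [← Real.mul_rpow hC (norm_nonneg _)]
            exact Real.rpow_le_rpow (norm_nonneg _) (h i) hp0.le
        _ = C ^ p.toReal * ∑ k, ({i | s i = k}.ncard : ℝ) * ‖g k‖ ^ p.toReal := by
            rw [← Finset.mul_sum, ← Finset.sum_fiberwise (s := Finset.univ) (g := s)]
            congr 1
            refine Finset.sum_congr rfl fun k _ => ?_
            rw [Finset.sum_congr rfl (g := fun _ => ‖g k‖ ^ p.toReal)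
              (fun i hi => by rw [(Finset.mem_filter.1 hi).2]), Finset.sum_const, nsmul_eq_mul,
              ← Set.ncard_coe_finset]
            simp
        -- The crude bound `m ≤ m ^ p` gives a constant independent of `p`, valid for `p = ∞` too.
        _ ≤ C ^ p.toReal * ∑ k, (m : ℝ) ^ p.toReal * ‖g k‖ ^ p.toReal := by
            gcongr with k
            exact (Nat.cast_le.2 (hs k)).trans (Real.self_le_rpow_of_one_le hm' hpr)
        _ = (m * C) ^ p.toReal * ∑ k, ‖g k‖ ^ p.toReal := by
            rw [← Finset.mul_sum, Real.mul_rpow (by positivity) hC]; ring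
    calc (∑ i, ‖f i‖ ^ p.toReal) ^ (1 / p.toReal)
        ≤ ((m * C) ^ p.toReal * ∑ k, ‖g k‖ ^ p.toReal) ^ (1 / p.toReal) := by
          gcongr
      _ = m * C * (∑ k, ‖g k‖ ^ p.toReal) ^ (1 / p.toReal) := by
          rw [Real.mul_rpow (by positivity) (by positivity), one_div,
            Real.rpow_rpow_inv (by positivity) hp0.ne']

variable (p) in
/-- The `ℓ^p` norm of the restriction of a function to a finite set. -/
def locNorm (Ω : Finset ι) (f : ι → V) : ℝ :=
  ‖(WithLp.toLp p (fun i : Ω => f i) : PiLp p fun _ : Ω => V)‖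

lemma locNorm_nonneg (Ω : Finset ι) (f : ι → V) : 0 ≤ locNorm p Ω f := norm_nonneg _

/-- The index types may be infinite, so fibres are measured by `encard`; `ncard` would count an
infinite fibre as `0`. -/
lemma locNorm_le_of_fiber {Ω : Finset ι} {Ω' : Finset κ} {f : ι → W} {g : κ → V}
    (s : ι → κ) (hs : ∀ i ∈ Ω, s i ∈ Ω') {m : ℕ} (hm : 1 ≤ m)
    (hcard : ∀ k, {i | s i = k}.encard ≤ m) {C : ℝ} (hC : 0 ≤ C)
    (h : ∀ i ∈ Ω, ‖f i‖ ≤ C * ‖g (s i)‖) :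
    locNorm p Ω f ≤ m * C * locNorm p Ω' g := by
  refine norm_toLp_le_of_fiber_card_le (fun i : Ω => (⟨s i, hs i i.2⟩ : Ω')) hm (fun k => ?_) hC
    fun i => h i i.2
  have h1 : (Subtype.val '' {i : Ω | (⟨s i, hs i i.2⟩ : Ω') = k}).encard ≤ m := by
    refine (Set.encard_le_encard ?_).trans (hcard k)
    rintro _ ⟨i, hi, rfl⟩
    exact congrArg Subtype.val hi
  rw [Subtype.val_injective.encard_image] at h1
  exact ENat.toNat_le_of_le_natCast h1


lemma locNorm_rpow (hp0 : 0 < p.toReal) (Ω : Finset ι) (f : ι → V) :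
    locNorm p Ω f ^ p.toReal = ∑ i ∈ Ω, ‖f i‖ ^ p.toReal := by
  unfold locNorm
  rw [PiLp.norm_eq_sum hp0, one_div, Real.rpow_inv_rpow (by positivity) hp0.ne']
  exact Finset.sum_coe_sort Ω fun i => ‖f i‖ ^ p.toReal

lemma norm_le_locNorm {Ω : Finset ι} (f : ι → V) {i : ι} (hi : i ∈ Ω) :
    ‖f i‖ ≤ locNorm p Ω f :=
  PiLp.norm_apply_le (WithLp.toLp p (fun i : Ω => f i) : PiLp p fun _ : Ω => V) ⟨i, hi⟩

/-- Only the indices of `Ω` with a nonzero value matter. -/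
lemma locNorm_le_of_support {Ω Ω' : Finset ι} {f : ι → V}
    (h : ∀ i ∈ Ω, f i ≠ 0 → i ∈ Ω') : locNorm p Ω f ≤ locNorm p Ω' f := by
  have hp1 : 1 ≤ p := Fact.out
  rcases eq_or_ne p ∞ with rfl | hp
  · refine Real.iSup_le (fun i : Ω => ?_) (locNorm_nonneg _ _)
    change ‖f i‖ ≤ _
    by_cases hi : f i = 0
    · rw [hi, norm_zero]
      exact locNorm_nonneg _ _
    · exact norm_le_locNorm f (h i i.2 hi)
  · have hp0 : 0 < p.toReal := ENNReal.toReal_pos (zero_lt_one.trans_le hp1).ne' hp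
    rw [← Real.rpow_le_rpow_iff (locNorm_nonneg _ _) (locNorm_nonneg _ _) hp0, locNorm_rpow hp0,
      locNorm_rpow hp0]
    classical
    rw [← Finset.sum_filter_ne_zero]
    refine Finset.sum_le_sum_of_subset_of_nonneg (fun i hi => ?_) fun i _ _ => by positivity
    obtain ⟨hi, hne⟩ := Finset.mem_filter.1 hi
    refine h i hi fun h0 => hne ?_
    rw [h0, norm_zero, Real.zero_rpow hp0.ne']

lemma locNorm_le_norm (Ω : Finset ι) (f : lp (fun _ : ι => V) p) : locNorm p Ω f ≤ ‖f‖ := by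
  have hp1 : 1 ≤ p := Fact.out
  rcases eq_or_ne p ∞ with rfl | hp
  · unfold locNorm
    rw [PiLp.norm_eq_ciSup]
    exact Real.iSup_le (fun i => lp.norm_apply_le_norm (by simp) f i) (norm_nonneg _)
  · have hp0 : 0 < p.toReal := ENNReal.toReal_pos (zero_lt_one.trans_le hp1).ne' hp
    unfold locNorm
    rw [PiLp.norm_eq_sum hp0, one_div,
      Real.rpow_inv_le_iff_of_pos (by positivity) (norm_nonneg _) hp0]
    refine le_trans (le_of_eq ?_) (lp.sum_rpow_le_norm_rpow hp0 f Ω)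
    exact Finset.sum_coe_sort Ω fun i => ‖f i‖ ^ p.toReal

/-- Together with `norm_le_of_locNorm_le`, this reduces global estimates to local ones, with no
further case split on `p`. -/
lemma memℓp_of_locNorm_le {f : ι → V} {C : ℝ} (h : ∀ Ω, locNorm p Ω f ≤ C) : Memℓp f p := by
  have hp1 : 1 ≤ p := Fact.out
  rcases eq_or_ne p ∞ with rfl | hp
  · refine memℓp_infty ⟨C, ?_⟩
    rintro _ ⟨i, rfl⟩
    exact (norm_le_locNorm f (Finset.mem_singleton_self i)).trans (h {i})
  · have hp0 : 0 < p.toReal := ENNReal.toReal_pos (zero_lt_one.trans_le hp1).ne' hp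
    refine memℓp_gen' (C := C ^ p.toReal) fun s => ?_
    rw [← locNorm_rpow hp0]
    exact Real.rpow_le_rpow (locNorm_nonneg _ _) (h s) hp0.le

lemma norm_le_of_locNorm_le {f : lp (fun _ : ι => V) p} {C : ℝ}
    (h : ∀ Ω, locNorm p Ω f ≤ C) : ‖f‖ ≤ C := by
  have hp1 : 1 ≤ p := Fact.out
  have hC : 0 ≤ C := (locNorm_nonneg _ _).trans (h ∅)
  rcases eq_or_ne p ∞ with rfl | hp
  · exact lp.norm_le_of_forall_le hC fun i =>
      (norm_le_locNorm f (Finset.mem_singleton_self i)).trans (h {i})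
  · have hp0 : 0 < p.toReal := ENNReal.toReal_pos (zero_lt_one.trans_le hp1).ne' hp
    refine lp.norm_le_of_forall_sum_le hp0 hC fun s => ?_
    rw [← locNorm_rpow hp0]
    exact Real.rpow_le_rpow (locNorm_nonneg _ _) (h s) hp0.le

end Norms

/-! ### Behaviour of `ldim` under linear maps and added coordinates -/

section Width

variable {𝕜 E E' : Type*} [RCLike 𝕜] [AddCommGroup E] [Module 𝕜 E] [AddCommGroup E'] [Module 𝕜 E']

/-- If `f` is admissible for `X'`, then `f ∘ L` is admissible for `X`, with the same target. -/
lemma ldim_le_of_map {ε ε' : ℝ} {X : Set E} {X' : Set E'} {q : Seminorm 𝕜 E} {q' : Seminorm 𝕜 E'}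
    (L : E →ₗ[𝕜] E') (hL : ∀ x ∈ X, L x ∈ X') {C : ℝ} (hC : 0 ≤ C)
    (hq : ∀ x, q x ≤ C * q' (L x)) (hε : C * ε' ≤ ε) : ldim ε X q ≤ ldim ε' X' q' := by
  refine le_iInf₂ fun n ⟨f, hf⟩ => iInf₂_le n ⟨f ∘ₗ L, fun x hx x' hx' h h' => ?_⟩
  refine ((hq _).trans ?_).trans hε
  rw [map_sub]
  exact mul_le_mul_of_nonneg_left (hf _ (hL x hx) _ (hL x' hx') h h') hC

lemma ldim_mono {ε : ℝ} {X : Set E} {q q' : Seminorm 𝕜 E} (hq : ∀ x, q x ≤ q' x) :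
    ldim ε X q ≤ ldim ε X q' :=
  ldim_le_of_map LinearMap.id (fun _ hx => hx) zero_le_one (by simpa using hq) (one_mul ε).le

/-- Enlarging a seminorm by finitely many coordinates costs at most their number. -/
lemma ldim_le_add_finrank {F : Type*} [AddCommGroup F] [Module 𝕜 F] [FiniteDimensional 𝕜 F]
    {ε : ℝ} {X : Set E} {q q' : Seminorm 𝕜 E} (g : E →ₗ[𝕜] F)
    (hg : ∀ x, g x = 0 → q' x ≤ q x) :
    ldim ε X q' ≤ ldim ε X q + (Module.finrank 𝕜 F : ℕ∞) := by
  unfold ldim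
  rw [ENat.iInf₂_add]
  refine le_iInf₂ fun n ⟨f, hf⟩ => ?_
  let φ : ((Fin n → 𝕜) × F) ≃ₗ[𝕜] (Fin (n + Module.finrank 𝕜 F) → 𝕜) :=
    LinearEquiv.ofFinrankEq _ _ (by simp)
  refine (iInf₂_le (n + Module.finrank 𝕜 F)
    ⟨φ.toLinearMap ∘ₗ f.prod g, fun x hx x' hx' h h' => ?_⟩).trans (by simp)
  have h1 : (f.prod g) x = 0 := by simpa using h
  have h2 : (f.prod g) x' = 0 := by simpa using h'
  have h1 : f x = 0 ∧ g x = 0 := by simpa using h1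
  have h2 : f x' = 0 ∧ g x' = 0 := by simpa using h2
  exact (hg _ (by rw [map_sub, h1.2, h2.2, sub_zero])).trans (hf x hx x' hx' h1.1 h2.1)

end Width

/-! ### Comparing nested finite sets -/

section SubsetComparison

variable {𝕜 Γ V : Type*} [RCLike 𝕜] [NormedAddCommGroup V] [NormedSpace 𝕜 V]
  {p : ℝ≥0∞} [Fact (1 ≤ p)]

lemma evSeminorm_apply (Ω : Finset Γ) (y : lp (fun _ : Γ => V) p) :
    evSeminorm 𝕜 Ω y = locNorm p Ω y := rfl

lemma ldim_evSeminorm_mono {ε : ℝ} {X : Set (lp (fun _ : Γ => V) p)} {Ω Ω' : Finset Γ}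
    (h : Ω ⊆ Ω') : ldim ε X (evSeminorm 𝕜 Ω) ≤ ldim ε X (evSeminorm 𝕜 Ω') :=
  ldim_mono fun y => locNorm_le_of_support (f := y) fun _ hi _ => h hi

variable [FiniteDimensional 𝕜 V]

omit [Fact (1 ≤ p)] in
lemma finrank_piLp (Ω : Finset Γ) :
    Module.finrank 𝕜 (PiLp p (fun _ : Ω => V)) = Ω.card * Module.finrank 𝕜 V := by
  rw [(WithLp.linearEquiv p 𝕜 (Ω → V)).finrank_eq, Module.finrank_pi_fintype]
  simp

/-- The added coordinates are the values on `Ω' \ Ω`: once these vanish, the norm on `Ω'` only sees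
`Ω`. -/
lemma ldim_evSeminorm_le_add [DecidableEq Γ] {ε : ℝ} {X : Set (lp (fun _ : Γ => V) p)}
    (Ω Ω' : Finset Γ) :
    ldim ε X (evSeminorm 𝕜 Ω') ≤
      ldim ε X (evSeminorm 𝕜 Ω) + (((Ω' \ Ω).card * Module.finrank 𝕜 V : ℕ) : ℕ∞) := by
  rw [← finrank_piLp (𝕜 := 𝕜) (V := V) (p := p)]
  refine ldim_le_add_finrank (restrict 𝕜 (Ω' \ Ω)) fun y hy => ?_
  refine locNorm_le_of_support (f := y) fun i hi hne => ?_
  by_contra hi'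
  exact hne (congrFun (congrArg WithLp.ofLp hy) ⟨i, Finset.mem_sdiff.2 ⟨hi, hi'⟩⟩)

/-- Enlarging the sets of a sequence by a negligible proportion does not change the dimension. -/
lemma lpDimAlong_eq_of_subset [DecidableEq Γ] {Ω Ω' : ℕ → Finset Γ}
    (Y : Submodule 𝕜 (lp (fun _ : Γ => V) p)) (hne : ∀ i, (Ω i).Nonempty) (hsub : ∀ i, Ω i ⊆ Ω' i)
    (hlim : Tendsto (fun i => ((Ω' i \ Ω i).card : ℝ) / (Ω i).card) atTop (𝓝 0)) :
    lpDimAlong Ω Y = lpDimAlong Ω' Y := by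
  set s : ℕ → ℝ≥0∞ := fun i => ((Ω' i \ Ω i).card : ℝ≥0∞) / (Ω i).card with hs
  have hc : ∀ i, ((Ω i).card : ℝ≥0∞) ≠ 0 := fun i => by simpa using (hne i).ne_empty
  have hs0 : Tendsto s atTop (𝓝 0) := by
    have h := ENNReal.tendsto_ofReal hlim
    rw [ENNReal.ofReal_zero] at h
    refine h.congr fun i => ?_
    rw [ENNReal.ofReal_div_of_pos (by exact_mod_cast (hne i).card_pos)]
    simp [hs]
  have hd : Tendsto (fun i => (Module.finrank 𝕜 V : ℝ≥0∞) * s i) atTop (𝓝 0) := by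
    simpa using ENNReal.Tendsto.const_mul hs0 (Or.inr (ENNReal.natCast_ne_top _))
  unfold lpDimAlong
  refine iSup_congr fun ε => iSup_congr fun hε => ?_
  unfold meanLdim
  set a : ℕ → ℝ≥0∞ := fun i => ((ldim ε (unitBall Y) (evSeminorm 𝕜 (Ω i)) : ℕ∞) : ℝ≥0∞) with ha
  set b : ℕ → ℝ≥0∞ := fun i => ((ldim ε (unitBall Y) (evSeminorm 𝕜 (Ω' i)) : ℕ∞) : ℝ≥0∞) with hb
  have hab : ∀ i, a i ≤ b i := fun i => ENat.toENNReal_le.2 (ldim_evSeminorm_mono (hsub i))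
  have hba : ∀ i, b i ≤ a i + (Ω' i \ Ω i).card * Module.finrank 𝕜 V := fun i => by
    have := ENat.toENNReal_le.2 (ldim_evSeminorm_le_add (𝕜 := 𝕜) (ε := ε) (X := unitBall Y) (Ω i) (Ω' i))
    simpa using this
  -- Comparison with the empty set. This a priori bound turns the relative error `s i` into an
  -- additive one that tends to `0`.
  have hbd : ∀ i, b i ≤ (Ω' i).card * Module.finrank 𝕜 V := fun i => by
    have h := ldim_evSeminorm_le_add (𝕜 := 𝕜) (ε := ε) (X := unitBall Y) ∅ (Ω' i)
    have h0 : ldim ε (unitBall Y) (evSeminorm 𝕜 (∅ : Finset Γ)) = 0 := by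
      refine le_antisymm (iInf₂_le 0 ⟨0, fun x _ x' _ _ _ => ?_⟩) bot_le
      refine le_trans (le_of_eq ?_) hε.le
      have : restrict 𝕜 (∅ : Finset Γ) (x - x') = 0 := by
        ext i
        exact absurd i.2 (Finset.notMem_empty _)
      simp [evSeminorm, this]
    rw [h0, Finset.sdiff_empty, zero_add] at h
    simpa using ENat.toENNReal_le.2 h
  have hcard : ∀ i, ((Ω' i).card : ℝ≥0∞) = (Ω i).card + (Ω' i \ Ω i).card := fun i => by
    rw [← Finset.card_sdiff_add_card_eq_card (hsub i)]
    push_cast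
    ring
  have hΩ' : ∀ i, ((Ω' i).card : ℝ≥0∞) ≠ 0 := fun i => by
    simpa using ((hne i).mono (hsub i)).ne_empty
  refine le_antisymm ?_ ?_
  · refine (limsup_le_limsup (v := fun i => b i / (Ω' i).card + Module.finrank 𝕜 V * s i)
      (Eventually.of_forall fun i => ?_)).trans
        (ENNReal.limsup_add_of_right_tendsto_zero hd _).le
    have h1 : b i / (Ω' i).card ≤ Module.finrank 𝕜 V :=
      ENNReal.div_le_of_le_mul ((hbd i).trans_eq (mul_comm _ _))
    calc a i / (Ω i).card ≤ b i / (Ω i).card := ENNReal.div_le_div_right (hab i) _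
      _ = b i / (Ω' i).card * ((Ω' i).card / (Ω i).card) := by
          rw [← mul_div_assoc, ENNReal.div_mul_cancel (hΩ' i) (ENNReal.natCast_ne_top _)]
      _ = b i / (Ω' i).card * (1 + s i) := by
          rw [hcard i, ENNReal.add_div, ENNReal.div_self (hc i) (ENNReal.natCast_ne_top _)]
      _ ≤ b i / (Ω' i).card + Module.finrank 𝕜 V * s i := by
          rw [mul_add, mul_one]
          gcongr
  · refine (limsup_le_limsup (v := fun i => a i / (Ω i).card + Module.finrank 𝕜 V * s i)
      (Eventually.of_forall fun i => ?_)).trans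
        (ENNReal.limsup_add_of_right_tendsto_zero hd _).le
    calc b i / (Ω' i).card ≤ b i / (Ω i).card :=
          ENNReal.div_le_div_left (by exact_mod_cast Finset.card_le_card (hsub i)) _
      _ ≤ (a i + (Ω' i \ Ω i).card * Module.finrank 𝕜 V) / (Ω i).card :=
          ENNReal.div_le_div_right (hba i) _
      _ = a i / (Ω i).card + Module.finrank 𝕜 V * s i := by
          rw [ENNReal.add_div, hs, mul_comm, mul_div_assoc]

end SubsetComparison

/-! ### The decomposition `g = γ₁ t` -/

section Transversal

variable {Γ₂ : Type*} [Group Γ₂] {Γ₁ : Subgroup Γ₂} {T : Finset Γ₂}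

/-- The `Γ₁`-component of `g = γ₁ t`. -/
def subPart (hT : Subgroup.IsComplement (Γ₁ : Set Γ₂) (T : Set Γ₂)) (g : Γ₂) : Γ₁ :=
  (hT.equiv g).1

/-- The representative of the coset `Γ₁ g`. -/
def repPart (hT : Subgroup.IsComplement (Γ₁ : Set Γ₂) (T : Set Γ₂)) (g : Γ₂) : T :=
  (hT.equiv g).2

variable (hT : Subgroup.IsComplement (Γ₁ : Set Γ₂) (T : Set Γ₂))

lemma subPart_mul_repPart (g : Γ₂) : (subPart hT g : Γ₂) * (repPart hT g : Γ₂) = g :=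
  hT.equiv_fst_mul_equiv_snd g

lemma equiv_mul (γ : Γ₁) (t : T) : hT.equiv ((γ : Γ₂) * (t : Γ₂)) = (γ, t) :=
  hT.equiv.apply_symm_apply (γ, t)

lemma subPart_mul (γ : Γ₁) (t : T) : subPart hT ((γ : Γ₂) * (t : Γ₂)) = γ :=
  congrArg Prod.fst (equiv_mul hT γ t)

lemma repPart_mul (γ : Γ₁) (t : T) : repPart hT ((γ : Γ₂) * (t : Γ₂)) = t :=
  congrArg Prod.snd (equiv_mul hT γ t)

include hT in
lemma transversal_nonempty : T.Nonempty := by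
  simpa using hT.nonempty_right

lemma mul_mem_mulTransversal {Ω : Finset Γ₁} {γ : Γ₁} (hγ : γ ∈ Ω) (t : T) :
    (γ : Γ₂) * (t : Γ₂) ∈ mulTransversal Ω T := by
  classical
  exact Finset.mem_image.2 ⟨(γ, t), Finset.mem_product.2 ⟨hγ, t.2⟩, rfl⟩

lemma mem_mulTransversal {Ω : Finset Γ₁} {g : Γ₂} :
    g ∈ mulTransversal Ω T ↔ subPart hT g ∈ Ω := by
  classical
  constructor
  · intro h
    obtain ⟨⟨γ, t⟩, hx, rfl⟩ := Finset.mem_image.1 h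
    obtain ⟨h1, h2⟩ := Finset.mem_product.1 hx
    exact (subPart_mul hT γ ⟨t, h2⟩).symm ▸ h1
  · intro h
    rw [← subPart_mul_repPart hT g]
    exact mul_mem_mulTransversal h _

lemma encard_subPart_fiber (γ : Γ₁) : {g | subPart hT g = γ}.encard ≤ T.card := by
  have hinj : Set.InjOn (repPart hT) {g | subPart hT g = γ} := fun g hg g' hg' h => by
    rw [← subPart_mul_repPart hT g, ← subPart_mul_repPart hT g', h, hg, hg']
  rw [← hinj.encard_image]
  refine (Set.encard_le_encard (Set.subset_univ _)).trans ?_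
  simp [Set.encard_univ]

include hT in
lemma card_mulTransversal (Ω : Finset Γ₁) :
    (mulTransversal Ω T).card = Ω.card * T.card := by
  classical
  unfold mulTransversal
  rw [Finset.card_image_of_injOn, Finset.card_product]
  rintro ⟨γ, t⟩ h ⟨γ', t'⟩ h' heq
  have ht := (Finset.mem_product.1 h).2
  have ht' := (Finset.mem_product.1 h').2
  have h1 := subPart_mul hT γ ⟨t, ht⟩
  have h2 := repPart_mul hT γ ⟨t, ht⟩
  simp only at heq h1 h2
  rw [heq] at h1 h2
  rw [subPart_mul hT γ' ⟨t', ht'⟩] at h1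
  rw [repPart_mul hT γ' ⟨t', ht'⟩] at h2
  simp_all

include hT in
lemma index_eq_card : Γ₁.index = T.card := by
  rw [← hT.card_right]
  simp

end Transversal

/-! ### The folding isomorphism and the identity along `ΩT` -/

section Restriction

lemma exists_norm_le {𝕜 ι V W : Type*} [RCLike 𝕜] [Fintype ι] [NormedAddCommGroup V]
    [NormedSpace 𝕜 V] [FiniteDimensional 𝕜 V] [NormedAddCommGroup W] [NormedSpace 𝕜 W]
    (e : W ≃ₗ[𝕜] (ι → V)) :
    ∃ C : ℝ, 0 < C ∧ (∀ v, ‖e.symm v‖ ≤ C * ‖v‖) ∧ ∀ w, ‖e w‖ ≤ C * ‖w‖ := by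
  have : FiniteDimensional 𝕜 W := e.symm.finiteDimensional
  let A : W →L[𝕜] (ι → V) := LinearMap.toContinuousLinearMap e.toLinearMap
  let B : (ι → V) →L[𝕜] W := LinearMap.toContinuousLinearMap e.symm.toLinearMap
  -- The `+ 1` keeps the constant positive even when the spaces are zero.
  refine ⟨‖A‖ + ‖B‖ + 1, by positivity, fun v => (B.le_opNorm v).trans ?_,
    fun w => (A.le_opNorm w).trans ?_⟩ <;>
  · gcongr
    linarith [norm_nonneg A, norm_nonneg B]

variable {𝕜 Γ₂ V W : Type*} [RCLike 𝕜] [Group Γ₂]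
    [NormedAddCommGroup V] [NormedSpace 𝕜 V] [NormedAddCommGroup W] [NormedSpace 𝕜 W]
    {p : ℝ≥0∞} [Fact (1 ≤ p)] {Γ₁ : Subgroup Γ₂} {T : Finset Γ₂}
    (hT : Subgroup.IsComplement (Γ₁ : Set Γ₂) (T : Set Γ₂)) (e : W ≃ₗ[𝕜] (T → V))

include hT in
lemma locNorm_fold_le {C : ℝ} (hC : 0 ≤ C) (he : ∀ v, ‖e.symm v‖ ≤ C * ‖v‖) (Ω : Finset Γ₁)
    (y : Γ₂ → V) :
    locNorm p Ω (fun γ => e.symm fun t : T => y (γ * t)) ≤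
      C * locNorm p (mulTransversal Ω T) y := by
  have : Nonempty T := (transversal_nonempty hT).to_subtype
  -- The sup norm of `(y (γ t))_t` is attained at `t = τ γ`, and `γ ↦ γ τ(γ)` is injective, so the
  -- fibre bound is `1`.
  choose τ hτ using fun γ : Γ₁ => Finite.exists_max fun t : T => ‖y (γ * t)‖
  have key := locNorm_le_of_fiber (p := p) (Ω := Ω) (Ω' := mulTransversal Ω T)
    (f := fun γ => e.symm fun t : T => y (γ * t)) (g := y)
    (fun γ => (γ : Γ₂) * (τ γ : Γ₂)) (fun γ hγ => mul_mem_mulTransversal hγ _) (m := 1) le_rfl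
    (fun g => ?_) hC fun γ _ => ?_
  · simpa using key
  · rw [Nat.cast_one, Set.encard_le_one_iff]
    intro a b ha hb
    rw [← subPart_mul hT a (τ a), ← subPart_mul hT b (τ b)]
    exact congrArg _ (Eq.trans ha (Eq.symm hb))
  · refine (he _).trans (mul_le_mul_of_nonneg_left ?_ hC)
    exact (pi_norm_le_iff_of_nonneg (norm_nonneg _)).2 fun t => hτ γ t

lemma locNorm_unfold_le {C : ℝ} (hC : 0 ≤ C) (he : ∀ w, ‖e w‖ ≤ C * ‖w‖) (Ω : Finset Γ₁)
    (w : Γ₁ → W) :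
    locNorm p (mulTransversal Ω T) (fun g => e (w (subPart hT g)) (repPart hT g)) ≤
      T.card * C * locNorm p Ω w :=
  locNorm_le_of_fiber (subPart hT) (fun _ hg => (mem_mulTransversal hT).1 hg)
    (transversal_nonempty hT).card_pos (encard_subPart_fiber hT) hC
    fun _ _ => (norm_le_pi_norm _ _).trans (he _)

variable [FiniteDimensional 𝕜 V]

include hT in
lemma exists_fold : ∃ C : ℝ, 0 < C ∧
    ∃ Φ : lp (fun _ : Γ₂ => V) p ≃ₗ[𝕜] lp (fun _ : Γ₁ => W) p,
      (∀ y γ t, e (Φ y γ) t = y ((γ : Γ₂) * (t : Γ₂))) ∧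
      (∀ y, ‖Φ y‖ ≤ C * ‖y‖) ∧ (∀ w, ‖Φ.symm w‖ ≤ C * ‖w‖) ∧
      (∀ Ω y, locNorm p Ω (Φ y) ≤ C * locNorm p (mulTransversal Ω T) y) ∧
      ∀ Ω w, locNorm p (mulTransversal Ω T) (Φ.symm w) ≤ C * locNorm p Ω w := by
  classical
  obtain ⟨C, hC, h1, h2⟩ := exists_norm_le e
  have hC2 : C ≤ T.card * C := le_mul_of_one_le_left hC.le
    (by exact_mod_cast (transversal_nonempty hT).card_pos)
  have fold : ∀ Ω (y : Γ₂ → V), locNorm p Ω (fun γ : Γ₁ => e.symm fun t : T => y (γ * t)) ≤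
      T.card * C * locNorm p (mulTransversal Ω T) y := fun Ω y =>
    (locNorm_fold_le hT e hC.le h1 Ω y).trans
      (mul_le_mul_of_nonneg_right hC2 (locNorm_nonneg _ _))
  have unfold' := fun Ω w => locNorm_unfold_le (p := p) hT e hC.le h2 Ω w
  have fold' : ∀ (y : lp (fun _ : Γ₂ => V) p) Ω,
      locNorm p Ω (fun γ : Γ₁ => e.symm fun t : T => y (γ * t)) ≤ T.card * C * ‖y‖ := fun y Ω =>
    (fold Ω y).trans (by gcongr; exact locNorm_le_norm _ _)
  have unfold'' : ∀ (w : lp (fun _ : Γ₁ => W) p) Ω,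
      locNorm p Ω (fun g => e (w (subPart hT g)) (repPart hT g)) ≤ T.card * C * ‖w‖ := by
    intro w Ω
    -- The local bound is available only on product sets, so `Ω` is first enlarged to one.
    refine (locNorm_le_of_support (Ω' := mulTransversal (Ω.image (subPart hT)) T)
      fun g hg _ => ?_).trans ((unfold' _ w).trans ?_)
    · exact (mem_mulTransversal hT).2 (Finset.mem_image_of_mem _ hg)
    · gcongr
      exact locNorm_le_norm _ _
  let Φ : lp (fun _ : Γ₂ => V) p ≃ₗ[𝕜] lp (fun _ : Γ₁ => W) p :=
    { toFun := fun y => ⟨fun γ => e.symm fun t : T => y (γ * t), memℓp_of_locNorm_le (fold' y)⟩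
      map_add' := fun y z => by
        ext γ
        exact map_add e.symm (fun t : T => y (γ * t)) (fun t : T => z (γ * t))
      map_smul' := fun c y => by
        ext γ
        exact map_smul e.symm c (fun t : T => y (γ * t))
      invFun := fun w => ⟨fun g => e (w (subPart hT g)) (repPart hT g),
        memℓp_of_locNorm_le (unfold'' w)⟩
      left_inv := fun y => by
        ext g
        change e (e.symm _) _ = y g
        rw [e.apply_symm_apply, subPart_mul_repPart]
      right_inv := fun w => by
        ext γ
        change e.symm (fun t : T => e (w (subPart hT (γ * t))) (repPart hT (γ * t))) = w γ
        simp only [subPart_mul, repPart_mul]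
        exact e.symm_apply_apply _ }
  refine ⟨T.card * C, hC.trans_le hC2, Φ, fun y γ t => ?_,
    fun y => norm_le_of_locNorm_le (fold' y), fun w => norm_le_of_locNorm_le (unfold'' w),
    fun Ω y => fold Ω y, fun Ω w => unfold' Ω w⟩
  exact congrFun (e.apply_symm_apply _) t

include hT in
lemma index_mul_lpDimAlong_mulTransversal (Ω : ℕ → Finset Γ₁)
    (Y : Submodule 𝕜 (lp (fun _ : Γ₂ => V) p)) :
    (Γ₁.index : ℝ≥0∞) * lpDimAlong (fun i => mulTransversal (Ω i) T) Y =
      lpDimAlong Ω (reduced Γ₁ T e Y) := by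
  obtain ⟨C, hC, Φ, hΦ, n1, n2, l1, l2⟩ := exists_fold (p := p) hT e
  have hmem : ∀ y, y ∈ Y ↔ Φ y ∈ reduced Γ₁ T e Y := fun y => by
    refine ⟨fun hy => ⟨y, hy, hΦ y⟩, ?_⟩
    rintro ⟨z, hz, h⟩
    have : y = z := by
      ext g
      have h' := h (subPart hT g) (repPart hT g)
      rwa [hΦ, subPart_mul_repPart] at h'
    exact this ▸ hz
  have hCC : ‖((C⁻¹ : ℝ) : 𝕜)‖ = C⁻¹ := by
    rw [RCLike.norm_ofReal, abs_of_pos (inv_pos.2 hC)]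
  -- The map `C⁻¹ Φ` sends unit ball to unit ball. One factor `C` undoes this scaling, the other is
  -- the local bound for `Φ.symm`; `key2` exchanges the roles.
  have key1 : ∀ (ε : ℝ) (S : Finset Γ₁),
      ldim (C * C * ε) (unitBall Y) (evSeminorm 𝕜 (mulTransversal S T)) ≤
        ldim ε (unitBall (reduced Γ₁ T e Y)) (evSeminorm 𝕜 S) := fun ε S => by
    refine ldim_le_of_map (((C⁻¹ : ℝ) : 𝕜) • Φ.toLinearMap) (fun y hy => ?_) (C := C * C)
      (by positivity) (fun y => ?_) le_rfl
    · refine ⟨Submodule.smul_mem _ _ ((hmem y).1 hy.1), ?_⟩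
      change ‖((C⁻¹ : ℝ) : 𝕜) • Φ y‖ ≤ 1
      rw [norm_smul, hCC, inv_mul_le_iff₀ hC]
      exact (n1 y).trans (mul_le_mul_of_nonneg_left hy.2 hC.le)
    · change _ ≤ C * C * evSeminorm 𝕜 S (((C⁻¹ : ℝ) : 𝕜) • Φ y)
      rw [map_smul_eq_mul, hCC, mul_assoc, mul_inv_cancel_left₀ hC.ne']
      simpa [evSeminorm_apply] using l2 S (Φ y)
  have key2 : ∀ (ε : ℝ) (S : Finset Γ₁),
      ldim (C * C * ε) (unitBall (reduced Γ₁ T e Y)) (evSeminorm 𝕜 S) ≤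
        ldim ε (unitBall Y) (evSeminorm 𝕜 (mulTransversal S T)) := fun ε S => by
    refine ldim_le_of_map (((C⁻¹ : ℝ) : 𝕜) • Φ.symm.toLinearMap) (fun w hw => ?_) (C := C * C)
      (by positivity) (fun w => ?_) le_rfl
    · refine ⟨Submodule.smul_mem _ _ ((hmem _).2 ?_), ?_⟩
      · simpa using hw.1
      change ‖((C⁻¹ : ℝ) : 𝕜) • Φ.symm w‖ ≤ 1
      rw [norm_smul, hCC, inv_mul_le_iff₀ hC]
      exact (n2 w).trans (mul_le_mul_of_nonneg_left hw.2 hC.le)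
    · change _ ≤ C * C * evSeminorm 𝕜 (mulTransversal S T) (((C⁻¹ : ℝ) : 𝕜) • Φ.symm w)
      rw [map_smul_eq_mul, hCC, mul_assoc, mul_inv_cancel_left₀ hC.ne']
      simpa [evSeminorm_apply] using l1 S (Φ.symm w)
  have hT0 : (T.card : ℝ≥0∞) ≠ 0 := by simpa using (transversal_nonempty hT).ne_empty
  have hdiv : ∀ (a : ℝ≥0∞) (S : Finset Γ₁),
      (T.card : ℝ≥0∞) * (a / ((mulTransversal S T).card : ℝ≥0∞)) = a / (S.card : ℝ≥0∞) :=
    fun a S => by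
      rw [card_mulTransversal hT, Nat.cast_mul, mul_comm (S.card : ℝ≥0∞), ← mul_div_assoc,
        ENNReal.mul_div_mul_left _ _ hT0 (ENNReal.natCast_ne_top _)]
  rw [index_eq_card hT]
  unfold lpDimAlong meanLdim
  simp only [ENNReal.mul_iSup]
  simp only [← ENNReal.limsup_const_mul_of_ne_top (ENNReal.natCast_ne_top T.card), hdiv]
  -- The loss `C * C` is absorbed by reindexing the supremum over `ε > 0`.
  have hε' : ∀ ε : ℝ, C * C * (ε / (C * C)) = ε := fun ε => by field_simp
  refine le_antisymm (iSup₂_le fun ε hε => ?_) (iSup₂_le fun ε hε => ?_)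
  · refine le_iSup₂_of_le (ε / (C * C)) (by positivity) (limsup_le_limsup
      (Eventually.of_forall fun i => ENNReal.div_le_div_right (ENat.toENNReal_le.2 ?_) _))
    simpa only [hε'] using key1 (ε / (C * C)) (Ω i)
  · refine le_iSup₂_of_le (ε / (C * C)) (by positivity) (limsup_le_limsup
      (Eventually.of_forall fun i => ENNReal.div_le_div_right (ENat.toENNReal_le.2 ?_) _))
    simpa only [hε'] using key2 (ε / (C * C)) (Ω i)

end Restriction

/-! ### Transfer of Følner sequences between `Γ₁` and `Γ₂` -/

section Folner

variable {Γ₂ : Type*} [Group Γ₂]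

/-- The boundary lies in `Ω F⁻¹`. Comparing sizes by `ncard` requires this finiteness. -/
lemma boundary_finite {Γ : Type*} [Group Γ] (F Ω : Finset Γ) : (boundary F Ω).Finite := by
  classical
  refine (Finset.finite_toSet ((Ω ×ˢ F).image fun x => x.1 * x.2⁻¹)).subset ?_
  rintro γ ⟨⟨f, hf, hγ⟩, -⟩
  exact Finset.mem_coe.2 (Finset.mem_image.2 ⟨(γ * f, f), Finset.mem_product.2 ⟨hγ, hf⟩, by simp⟩)

lemma relAmen_nonneg {Γ : Type*} [Group Γ] (Ω F : Finset Γ) : 0 ≤ relAmen Ω F := by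
  unfold relAmen
  positivity

variable {Γ₁ : Subgroup Γ₂} {T : Finset Γ₂}
  (hT : Subgroup.IsComplement (Γ₁ : Set Γ₂) (T : Set Γ₂))

open Classical in
/-- The `Γ₁`-components of the products `t f` with `t ∈ T` and `f ∈ F`. -/
def shiftedParts (F : Finset Γ₂) : Finset Γ₁ :=
  (T ×ˢ F).image fun x => subPart hT (x.1 * x.2)

lemma subPart_mul_left (γ : Γ₁) (g : Γ₂) : subPart hT ((γ : Γ₂) * g) = γ * subPart hT g := by
  conv_lhs => rw [← subPart_mul_repPart hT g, ← mul_assoc, ← Subgroup.coe_mul]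
  exact subPart_mul hT _ _

/-- For `g = γ t`, left `Γ₁`-equivariance of `subPart` shows that `g f ∈ ΩT` exactly when `γ *
subPart hT (t f) ∈ Ω`. -/
lemma subPart_mem_boundary {F : Finset Γ₂} {Ω : Finset Γ₁} {g : Γ₂}
    (hg : g ∈ boundary F (mulTransversal Ω T)) :
    subPart hT g ∈ boundary (shiftedParts hT F) Ω := by
  classical
  have h : ∀ f ∈ F, ∃ f' ∈ shiftedParts hT F,
      (g * f ∈ mulTransversal Ω T ↔ subPart hT g * f' ∈ Ω) := fun f hf => by
    refine ⟨subPart hT (repPart hT g * f),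
      Finset.mem_image.2 ⟨(repPart hT g, f), Finset.mem_product.2 ⟨(repPart hT g).2, hf⟩, rfl⟩, ?_⟩
    rw [mem_mulTransversal hT, ← subPart_mul_left, ← mul_assoc, subPart_mul_repPart]
  obtain ⟨⟨f, hf, h1⟩, k, hk, h2⟩ := hg
  obtain ⟨f', hf', hf1⟩ := h f hf
  obtain ⟨k', hk', hk1⟩ := h k hk
  exact ⟨⟨f', hf', hf1.1 h1⟩, k', hk', fun hc => h2 (hk1.2 hc)⟩

/-- A set whose `Γ₁`-components lie in a finite set `B` has at most `|T| |B|` elements. -/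
lemma ncard_le_of_subPart_mem {A : Set Γ₂} {B : Set Γ₁} (hB : B.Finite)
    (h : ∀ g ∈ A, subPart hT g ∈ B) : A.ncard ≤ B.ncard * T.card := by
  classical
  rw [Set.ncard_eq_toFinset_card B hB, ← card_mulTransversal hT, ← Set.ncard_coe_finset]
  refine Set.ncard_le_ncard (fun g hg => ?_) (Finset.finite_toSet _)
  exact (mem_mulTransversal hT).2 (hB.mem_toFinset.2 (h g hg))

include hT in
lemma IsFolnerSeq.mulTransversal {Ω : ℕ → Finset Γ₁} (hΩ : IsFolnerSeq Ω) :
    IsFolnerSeq fun i => mulTransversal (Ω i) T := by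
  obtain ⟨t, ht⟩ := transversal_nonempty hT
  refine ⟨fun i => ?_, fun F => ?_⟩
  · obtain ⟨γ, hγ⟩ := hΩ.1 i
    exact ⟨_, mul_mem_mulTransversal hγ ⟨t, ht⟩⟩
  · refine squeeze_zero (fun i => relAmen_nonneg _ _) (fun i => ?_) (hΩ.2 (shiftedParts hT F))
    have hT0 : (0 : ℝ) < T.card := by exact_mod_cast Finset.card_pos.2 ⟨t, ht⟩
    have h := ncard_le_of_subPart_mem hT (boundary_finite (shiftedParts hT F) (Ω i))
      fun g hg => subPart_mem_boundary hT hg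
    unfold relAmen
    rw [card_mulTransversal hT, Nat.cast_mul, ← mul_div_mul_right _ ((Ω i).card : ℝ) hT0.ne']
    gcongr
    exact_mod_cast h

open Classical in
/-- The elements `γ` of `Γ₁` for which `γT` meets `Ω`. -/
def hull (Ω : Finset Γ₂) : Finset Γ₁ := Ω.image (subPart hT)

lemma mem_hull {Ω : Finset Γ₂} {γ : Γ₁} : γ ∈ hull hT Ω ↔ ∃ t ∈ T, (γ : Γ₂) * t ∈ Ω := by
  classical
  constructor
  · intro h
    obtain ⟨g, hg, rfl⟩ := Finset.mem_image.1 h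
    exact ⟨repPart hT g, (repPart hT g).2, (subPart_mul_repPart hT g).symm ▸ hg⟩
  · rintro ⟨t, ht, h⟩
    exact Finset.mem_image.2 ⟨_, h, subPart_mul hT γ ⟨t, ht⟩⟩

lemma subset_mulTransversal_hull (Ω : Finset Γ₂) : Ω ⊆ mulTransversal (hull hT Ω) T := by
  classical
  exact fun g hg => (mem_mulTransversal hT).2 (Finset.mem_image_of_mem _ hg)

/-- Since `γ f ∈ hull Ω` means `γ f t ∈ Ω` for some `t`, while `γ k ∉ hull Ω` means `γ k t ∉ Ω` for
every `t`, the inclusion of `Γ₁` sends `∂_F (hull Ω)` into `∂_{FT} Ω`. -/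
lemma ncard_boundary_hull_le (F : Finset Γ₁) (Ω : Finset Γ₂) :
    (boundary F (hull hT Ω)).ncard ≤ (boundary (mulTransversal F T) Ω).ncard := by
  refine Set.ncard_le_ncard_of_injOn (fun γ : Γ₁ => (γ : Γ₂)) ?_ Subtype.val_injective.injOn
    (boundary_finite _ _)
  rintro γ ⟨⟨f, hf, h1⟩, k, hk, h2⟩
  obtain ⟨t, ht, h1⟩ := (mem_hull hT).1 h1
  refine ⟨⟨f * t, mul_mem_mulTransversal hf ⟨t, ht⟩, ?_⟩,
    k * t, mul_mem_mulTransversal hk ⟨t, ht⟩, fun h => h2 ((mem_hull hT).2 ⟨t, ht, ?_⟩)⟩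
  · simpa [mul_assoc] using h1
  · simpa [mul_assoc] using h

lemma IsFolnerSeq.hull {Ω : ℕ → Finset Γ₂} (hΩ : IsFolnerSeq Ω) :
    IsFolnerSeq fun i => hull hT (Ω i) := by
  classical
  refine ⟨fun i => (hΩ.1 i).image _, fun F => ?_⟩
  have hlim := (hΩ.2 (LpDim.mulTransversal F T)).const_mul (T.card : ℝ)
  rw [mul_zero] at hlim
  refine squeeze_zero (fun i => relAmen_nonneg _ _) (fun i => ?_) hlim
  have hpos : (0 : ℝ) < (Ω i).card := by exact_mod_cast (hΩ.1 i).card_pos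
  have hpos' : (0 : ℝ) < (LpDim.hull hT (Ω i)).card := by
    exact_mod_cast ((hΩ.1 i).image (subPart hT)).card_pos
  have h1 : ((boundary F (LpDim.hull hT (Ω i))).ncard : ℝ) ≤
      (boundary (LpDim.mulTransversal F T) (Ω i)).ncard := by
    exact_mod_cast ncard_boundary_hull_le hT F (Ω i)
  have h2 : ((Ω i).card : ℝ) ≤ (LpDim.hull hT (Ω i)).card * T.card := by
    rw [← Nat.cast_mul, ← card_mulTransversal hT]
    exact_mod_cast Finset.card_le_card (subset_mulTransversal_hull hT (Ω i))
  unfold relAmen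
  rw [← mul_div_assoc, div_le_div_iff₀ hpos' hpos]
  calc _ ≤ ((boundary (LpDim.mulTransversal F T) (Ω i)).ncard : ℝ) *
        ((LpDim.hull hT (Ω i)).card * T.card) := by gcongr
    _ = _ := by ring

/-- If `γ t` is an added point, then `γT` meets `Ω` because `γ` is in the hull, and leaves it at `γ
t`; hence `γ ∈ ∂_T Ω`. -/
lemma card_mulTransversal_hull_sdiff_le [DecidableEq Γ₂] (Ω : Finset Γ₂) :
    (mulTransversal (hull hT Ω) T \ Ω).card ≤ (boundary T Ω).ncard * T.card := by
  rw [← Set.ncard_coe_finset]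
  have hfin : {γ : Γ₁ | (γ : Γ₂) ∈ boundary T Ω}.Finite :=
    (boundary_finite T Ω).preimage Subtype.val_injective.injOn
  refine (ncard_le_of_subPart_mem hT hfin fun g hg => ?_).trans (Nat.mul_le_mul_right _
    (Set.ncard_le_ncard_of_injOn (fun γ : Γ₁ => (γ : Γ₂)) (fun γ hγ => hγ)
      Subtype.val_injective.injOn (boundary_finite _ _)))
  obtain ⟨h1, h2⟩ := Finset.mem_sdiff.1 (Finset.mem_coe.1 hg)
  refine ⟨(mem_hull hT).1 ((mem_mulTransversal hT).1 h1), repPart hT g, (repPart hT g).2, ?_⟩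
  rwa [subPart_mul_repPart]

lemma lpDimAlong_mulTransversal_hull {𝕜 V : Type*} [RCLike 𝕜]
    [NormedAddCommGroup V] [NormedSpace 𝕜 V] [FiniteDimensional 𝕜 V] {p : ℝ≥0∞} [Fact (1 ≤ p)]
    {Ω : ℕ → Finset Γ₂} (hΩ : IsFolnerSeq Ω) (Y : Submodule 𝕜 (lp (fun _ : Γ₂ => V) p)) :
    lpDimAlong Ω Y = lpDimAlong (fun i => mulTransversal (hull hT (Ω i)) T) Y := by
  classical
  refine lpDimAlong_eq_of_subset Y hΩ.1 (fun i => subset_mulTransversal_hull hT (Ω i)) ?_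
  have hlim := (hΩ.2 T).mul_const (T.card : ℝ)
  rw [zero_mul] at hlim
  refine squeeze_zero (fun i => by positivity) (fun i => ?_) hlim
  unfold relAmen
  rw [div_mul_eq_mul_div]
  gcongr
  exact_mod_cast card_mulTransversal_hull_sdiff_le hT (Ω i)

end Folner

end LpDim

end

theorem proposition7p5 {𝕜 Γ₂ V W : Type*} [RCLike 𝕜] [Group Γ₂] [Countable Γ₂]
    [NormedAddCommGroup V] [NormedSpace 𝕜 V] [FiniteDimensional 𝕜 V]
    [NormedAddCommGroup W] [NormedSpace 𝕜 W]
    (p : ℝ≥0∞) [Fact (1 ≤ p)] (hΓ₂ : LpDim.IsAmenable Γ₂)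
    (Γ₁ : Subgroup Γ₂) [Γ₁.FiniteIndex]
    -- representatives of the cosets `Γ₁ t`, and the space `V^T` with an arbitrary norm
    (T : Finset Γ₂) (hT : Subgroup.IsComplement (Γ₁ : Set Γ₂) (T : Set Γ₂))
    (e : W ≃ₗ[𝕜] (T → V))
    (Y : Submodule 𝕜 (lp (fun _ : Γ₂ => V) p)) (hY : LpDim.IsInvariant Y) :
    -- the identity for the dimensions
    (Γ₁.index : ℝ≥0∞) * LpDim.lpDim Y = LpDim.lpDim (LpDim.reduced Γ₁ T e Y) ∧
    -- the identity along any Følner sequence of `Γ₁` and the corresponding one of `Γ₂`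
    (∀ Ω : ℕ → Finset Γ₁, LpDim.IsFolnerSeq Ω →
      LpDim.IsFolnerSeq (fun i => LpDim.mulTransversal (Ω i) T) ∧
      (Γ₁.index : ℝ≥0∞) * LpDim.lpDimAlong (fun i => LpDim.mulTransversal (Ω i) T) Y =
        LpDim.lpDimAlong Ω (LpDim.reduced Γ₁ T e Y)) ∧
    -- the identity along any Følner sequence of `Γ₂` and a suitable one of `Γ₁`
    (∀ Ω : ℕ → Finset Γ₂, LpDim.IsFolnerSeq Ω →
      ∃ Ω' : ℕ → Finset Γ₁, LpDim.IsFolnerSeq Ω' ∧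
        (Γ₁.index : ℝ≥0∞) * LpDim.lpDimAlong Ω Y =
          LpDim.lpDimAlong Ω' (LpDim.reduced Γ₁ T e Y)) := by
  have h1 : ∀ Ω : ℕ → Finset Γ₁, LpDim.IsFolnerSeq Ω →
      LpDim.IsFolnerSeq (fun i => LpDim.mulTransversal (Ω i) T) ∧
      (Γ₁.index : ℝ≥0∞) * LpDim.lpDimAlong (fun i => LpDim.mulTransversal (Ω i) T) Y =
        LpDim.lpDimAlong Ω (LpDim.reduced Γ₁ T e Y) := fun Ω hΩ =>
    ⟨hΩ.mulTransversal hT, LpDim.index_mul_lpDimAlong_mulTransversal hT e Ω Y⟩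
  have h2 : ∀ Ω : ℕ → Finset Γ₂, LpDim.IsFolnerSeq Ω →
      ∃ Ω' : ℕ → Finset Γ₁, LpDim.IsFolnerSeq Ω' ∧
        (Γ₁.index : ℝ≥0∞) * LpDim.lpDimAlong Ω Y =
          LpDim.lpDimAlong Ω' (LpDim.reduced Γ₁ T e Y) := fun Ω hΩ =>
    ⟨_, hΩ.hull hT, by
      rw [LpDim.lpDimAlong_mulTransversal_hull hT hΩ,
        LpDim.index_mul_lpDimAlong_mulTransversal hT e]⟩
  refine ⟨?_, h1, h2⟩
  unfold LpDim.lpDim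
  simp only [ENNReal.mul_iSup]
  -- Each Følner sequence of either group has a partner in the other with the same value.
  refine le_antisymm (iSup₂_le fun Ω hΩ => ?_) (iSup₂_le fun Ω hΩ => ?_)
  · obtain ⟨Ω', hΩ', h⟩ := h2 Ω hΩ
    exact h.trans_le (le_iSup₂_of_le Ω' hΩ' le_rfl)
  · obtain ⟨hΩ', h⟩ := h1 Ω hΩ
    exact h.symm.trans_le (le_iSup₂_of_le _ hΩ' le_rfl)
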